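/- Let $p \geq 5$ be a prime and let $S$ be a finite $p$-group. Notation. For a finite $p$-group $H$, $\Omega_1(H)$ is the subgroup generated by the elements $x \in H$ with $x^p = 1$, $Z(H)$ is the center of $H$, and $J_e(H)$ (the Thompson subgroup) is the subgroup generated by the elementary abelian subgroups of $H$ of maximum order. The Baumann subgroup of $H$ is $\mathrm{Baum}(H) = C_H(\Omega_1(Z(J_e(H))))$. For subgroups $A, B$ of a group put $[A,B;0] = A$ and $[A,B;n+1] = [[A,B;n],B]$. For $3 \leq k \leq p$, the $k$-th Oliver subgroup $\mathfrak{X}_k(S)$ is the largest subgroup of $S$ for which there exists a series \[ 1 = Q_0 < Q_1 < \cdots < Q_n = \mathfrak{X}_k(S) \] with each $Q_i$ normal in $S$ and $[\Omega_1(C_S(Q_{i-1})), Q_i; k-1] = 1$ for all $1 \leq i \leq n$. The Oliver subgroup is $\mathfrak{X}(S) = \mathfrak{X}_p(S)$, and Oliver's conjecture for $S$ is the assertion $J_e(S) \leq \mathfrak{X}(S)$. Theorem. Let $3 \leq k \leq p$ and set $G = S/\mathfrak{X}_k(S)$. If $\mathrm{Baum}(G) = G$, then $J_e(S) \leq \mathfrak{X}_k(S)$.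 In particular (taking $k = p$), if $G = S/\mathfrak{X}(S)$ satisfies $\mathrm{Baum}(G) = G$, then $J_e(S) \leq \mathfrak{X}(S)$, that is, Oliver's conjecture holds for $S$. -/

import Mathlib

namespace OliverGroup

/-- `Ω₁(H)` for a subgroup `H`: the subgroup generated by the elements `x` of `H` with `x ^ p = 1`. -/
def omegaOne (p : ℕ) {S : Type*} [Group S] (H : Subgroup S) : Subgroup S :=
  Subgroup.closure {x : S | x ∈ H ∧ x ^ p = 1}

/-- The center `Z(H)` of a subgroup `H`, as a subgroup of the ambient group. -/
def centerOf {S : Type*} [Group S] (H : Subgroup S) : Subgroup S :=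
  H ⊓ Subgroup.centralizer (H : Set S)

/-- The iterated commutator `[A, B; n]`: `[A, B; 0] = A` and `[A, B; n+1] = [[A, B; n], B]`. -/
def iterCommutator {S : Type*} [Group S] (A B : Subgroup S) : ℕ → Subgroup S
  | 0 => A
  | n + 1 => ⁅iterCommutator A B n, B⁆

/-- `A` is an elementary abelian `p`-subgroup (the trivial subgroup is allowed). -/
def IsElementaryAbelian (p : ℕ) {S : Type*} [Group S] (A : Subgroup S) : Prop :=
  (∀ x ∈ A, ∀ y ∈ A, x * y = y * x) ∧ ∀ x ∈ A, x ^ p = 1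

/-- `A` is an elementary abelian subgroup of maximum order (of a finite group). -/
def IsMaxElementaryAbelian (p : ℕ) {S : Type*} [Group S] (A : Subgroup S) : Prop :=
  IsElementaryAbelian p A ∧
    ∀ B : Subgroup S, IsElementaryAbelian p B → Nat.card B ≤ Nat.card A

/-- The Thompson subgroup `J_e(S)`, generated by the elementary abelian subgroups of
maximum order. -/
def thompson (p : ℕ) (S : Type*) [Group S] : Subgroup S :=
  sSup {A : Subgroup S | IsMaxElementaryAbelian p A}

/-- The Baumann subgroup `C_G(Ω₁(Z(J_e(G))))`. -/
def baumann (p : ℕ) (G : Type*) [Group G] : Subgroup G :=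
  Subgroup.centralizer (omegaOne p (centerOf (thompson p G)) : Set G)

/-- There is a series `1 = Q_0 < Q_1 < ... < Q_n = H` of normal subgroups of `S` such that
`[Ω₁(C_S(Q_{i-1})), Q_i; k-1] = 1` for `1 ≤ i ≤ n`. -/
def HasOliverSeries (p k : ℕ) {S : Type*} [Group S] (H : Subgroup S) : Prop :=
  ∃ (n : ℕ) (Q : ℕ → Subgroup S), Q 0 = ⊥ ∧ Q n = H ∧
    (∀ i ≤ n, (Q i).Normal) ∧
    (∀ i < n, Q i < Q (i + 1)) ∧
    ∀ i < n, iterCommutator (omegaOne p (Subgroup.centralizer (Q i : Set S)))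
      (Q (i + 1)) (k - 1) = ⊥

/-- The `k`-th Oliver subgroup `X_k(S)`: the largest subgroup having an Oliver series.
For finite `S` the supremum is attained, see `isGreatest_oliverK`. -/
def oliverK (p k : ℕ) (S : Type*) [Group S] : Subgroup S :=
  sSup {H : Subgroup S | HasOliverSeries p k H}

/-- The Oliver subgroup `X(S) = X_p(S)`. -/
def oliver (p : ℕ) (S : Type*) [Group S] : Subgroup S :=
  oliverK p p S

theorem HasOliverSeries.normal {p k : ℕ} {S : Type*} [Group S] {H : Subgroup S}
    (h : HasOliverSeries p k H) : H.Normal := by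
  obtain ⟨n, Q, -, rfl, hn, -⟩ := h
  exact hn n le_rfl

instance oliverK_normal (p k : ℕ) (S : Type*) [Group S] : (oliverK p k S).Normal :=
  Subgroup.sSup_normal _ fun _ hH => HasOliverSeries.normal hH

instance oliver_normal (p : ℕ) (S : Type*) [Group S] : (oliver p S).Normal :=
  oliverK_normal p p S

theorem hasOliverSeries_bot (p k : ℕ) (S : Type*) [Group S] :
    HasOliverSeries p k (⊥ : Subgroup S) :=
  ⟨0, fun _ => ⊥, rfl, rfl, fun _ _ => inferInstance, by simp, by simp⟩

theorem HasOliverSeries.extend {p k : ℕ} {S : Type*} [Group S] {H K : Subgroup S}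
    (h : HasOliverSeries p k H) (hK : K.Normal) (hle : H ≤ K)
    (hc : iterCommutator (omegaOne p (Subgroup.centralizer (H : Set S))) K (k - 1) = ⊥) :
    HasOliverSeries p k K := by
  rcases hle.eq_or_lt with rfl | hlt
  · exact h
  obtain ⟨n, Q, h0, rfl, hn, hs, hq⟩ := h
  refine ⟨n + 1, fun i => if i ≤ n then Q i else K, by simpa using h0, by simp, ?_, ?_, ?_⟩
  · intro i _
    by_cases hi : i ≤ n
    · simpa [hi] using hn i hi
    · simpa [hi] using hK
  · intro i hi
    rcases (Nat.lt_succ_iff.mp hi).eq_or_lt with rfl | hi'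
    · simpa using hlt
    · simpa [hi'.le, Nat.succ_le_of_lt hi'] using hs i hi'
  · intro i hi
    rcases (Nat.lt_succ_iff.mp hi).eq_or_lt with rfl | hi'
    · simpa using hc
    · simpa [hi'.le, Nat.succ_le_of_lt hi'] using hq i hi'

theorem omegaOne_le (p : ℕ) {S : Type*} [Group S] (H : Subgroup S) : omegaOne p H ≤ H :=
  (Subgroup.closure_le H).2 fun _ hx => hx.1

theorem omegaOne_mono (p : ℕ) {S : Type*} [Group S] {H K : Subgroup S} (h : H ≤ K) :
    omegaOne p H ≤ omegaOne p K :=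
  Subgroup.closure_mono fun _ hx => ⟨h hx.1, hx.2⟩

theorem omegaOne_normal (p : ℕ) {S : Type*} [Group S] {H : Subgroup S} (hH : H.Normal) :
    (omegaOne p H).Normal := by
  constructor
  intro x hx g
  have : (omegaOne p H).map (MulAut.conj g).toMonoidHom ≤ omegaOne p H := by
    unfold omegaOne
    rw [MonoidHom.map_closure]
    refine Subgroup.closure_mono ?_
    rintro _ ⟨y, ⟨hy, hyp⟩, rfl⟩
    refine ⟨hH.conj_mem y hy g, ?_⟩
    rw [← map_pow, hyp, map_one]
  exact this ⟨x, hx, rfl⟩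

theorem iterCommutator_normal {S : Type*} [Group S] {A B : Subgroup S}
    (hA : A.Normal) (hB : B.Normal) : ∀ n, (iterCommutator A B n).Normal
  | 0 => hA
  | n + 1 => by
    have := iterCommutator_normal hA hB n
    exact Subgroup.commutator_normal _ _

theorem iterCommutator_le {S : Type*} [Group S] {A B : Subgroup S}
    (hA : A.Normal) (hB : B.Normal) : ∀ n, iterCommutator A B n ≤ A
  | 0 => le_rfl
  | n + 1 => by
    have := iterCommutator_normal hA hB n
    exact (Subgroup.commutator_le_left _ _).trans (iterCommutator_le hA hB n)

open scoped commutatorElement in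
theorem iterCommutator_sup_le {S : Type*} [Group S] {W A B C : Subgroup S}
    (hW : W.Normal) (hB : B.Normal) (hC : C.Normal) (hWA : W ≤ A)
    (hWB : W ≤ Subgroup.centralizer (B : Set S)) :
    ∀ n, iterCommutator W (B ⊔ C) n ≤ iterCommutator A C n
  | 0 => hWA
  | n + 1 => by
    have hBC : (B ⊔ C).Normal := inferInstance
    have hT := iterCommutator_normal hW hBC n
    have hTW := iterCommutator_le hW hBC n
    refine le_trans ?_ (Subgroup.commutator_mono
      (iterCommutator_sup_le hW hB hC hWA hWB n) le_rfl)
    change ⁅iterCommutator W (B ⊔ C) n, B ⊔ C⁆ ≤ _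
    rw [Subgroup.commutator_le]
    intro t ht x hx
    obtain ⟨b, hb, c, hc, rfl⟩ := Subgroup.mem_sup_of_normal_right.mp hx
    have hN : (⁅iterCommutator W (B ⊔ C) n, C⁆).Normal := inferInstance
    have hbt : b * t = t * b := Subgroup.mem_centralizer_iff.mp (hWB (hTW ht)) b hb
    have h1 : ⁅t, b * c⁆ = b * ⁅t, c⁆ * b⁻¹ := by
      simp only [commutatorElement_def, mul_inv_rev, ← mul_assoc, hbt]
    rw [h1]
    exact hN.conj_mem _ (Subgroup.commutator_mem_commutator ht hc) b

theorem HasOliverSeries.sup {p k : ℕ} {S : Type*} [Group S] {H K : Subgroup S}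
    (hH : HasOliverSeries p k H) (hK : HasOliverSeries p k K) :
    HasOliverSeries p k (H ⊔ K) := by
  obtain ⟨n, Q, h0, rfl, hn, hs, hq⟩ := hK
  have key : ∀ i ≤ n, HasOliverSeries p k (H ⊔ Q i) := by
    intro i
    induction i with
    | zero => intro _; simpa [h0] using hH
    | succ i ih =>
      intro hi
      have hHn := hH.normal
      have hQi := hn i (by omega)
      have hQi1 := hn (i + 1) hi
      refine (ih (by omega)).extend inferInstance
        (sup_le_sup_left (hs i (by omega)).le H) ?_
      rw [eq_bot_iff, ← hq i (by omega)]
      have hle : ∀ L : Subgroup S, L ≤ H ⊔ Q i →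
          Subgroup.centralizer ((H ⊔ Q i : Subgroup S) : Set S) ≤
            Subgroup.centralizer (L : Set S) :=
        fun L hL => Subgroup.centralizer_le (SetLike.coe_subset_coe.2 hL)
      have hW : (omegaOne p (Subgroup.centralizer
          ((H ⊔ Q i : Subgroup S) : Set S))).Normal := omegaOne_normal p inferInstance
      have hWH : omegaOne p (Subgroup.centralizer ((H ⊔ Q i : Subgroup S) : Set S)) ≤
          Subgroup.centralizer (H : Set S) := (omegaOne_le p _).trans (hle H le_sup_left)
      exact iterCommutator_sup_le hW hHn hQi1 (omegaOne_mono p (hle _ le_sup_right)) hWH _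
  exact key n le_rfl

/-- In a finite group `X_k(S)` is indeed the largest subgroup with an Oliver series. -/
theorem isGreatest_oliverK (p k : ℕ) (S : Type*) [Group S] [Finite S] :
    IsGreatest {H : Subgroup S | HasOliverSeries p k H} (oliverK p k S) := by
  obtain ⟨M, hM⟩ := (Set.toFinite {H : Subgroup S | HasOliverSeries p k H}).exists_maximal
    ⟨⊥, hasOliverSeries_bot p k S⟩
  have hg : IsGreatest {H : Subgroup S | HasOliverSeries p k H} M :=
    ⟨hM.1, fun H hH => le_sup_right.trans (hM.2 (HasOliverSeries.sup hM.1 hH) le_sup_left)⟩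
  have : oliverK p k S = M := hg.isLUB.sSup_eq
  rw [this]
  exact hg

end OliverGroup

namespace OliverGroup

open scoped commutatorElement

/-! Put X = X_k(S), V = Ω₁(C_S(X)) and G = S/X. Maximality of X and k ≥ 3 give C_S(X) ≤ X and C_S(V)
= X, so V is elementary abelian and G acts on it faithfully. If J_e(S) were not contained in X =
C_S(V), Thompson replacement would yield b outside C_S(V) with [V,b,b] = 1: a nontrivial element of
G acting quadratically on V (`exists_forall_commute_commutator`).

The main step moves such an element into Z(G) when Baum(G) = G (`IsQuadraticSet.exists_mem_center`).
Only formal properties of quadratic elements are needed, above all that [t,a] is quadratic whenever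
a is quadratic and commutes, as does t, with [t,a]; this uses that 2 is invertible on V.

Finally, a lift s of a central quadratic element makes X⟨s⟩ normal with [V, X⟨s⟩; 2] = 1. As 2 ≤ k -
1, it extends the Oliver series, so s ∈ X, a contradiction (`mem_oliverK_of_forall_commute`). -/

/-! ### Elementary abelian subgroups and Thompson replacement. -/

theorem isElementaryAbelian_closure {p : ℕ} {G : Type*} [Group G] {s : Set G}
    (hc : ∀ x ∈ s, ∀ y ∈ s, x * y = y * x) (hp : ∀ x ∈ s, x ^ p = 1) :
    IsElementaryAbelian p (Subgroup.closure s) := by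
  have h1 : ∀ x ∈ s, ∀ y ∈ Subgroup.closure s, x * y = y * x := by
    intro x hx y hy
    have : Subgroup.closure s ≤ Subgroup.centralizer {x} :=
      (Subgroup.closure_le _).2 fun z hz =>
        Subgroup.mem_centralizer_singleton_iff.2 (hc z hz x hx)
    exact (Subgroup.mem_centralizer_singleton_iff.1 (this hy)).symm
  have h2 : ∀ x ∈ Subgroup.closure s, ∀ y ∈ Subgroup.closure s, x * y = y * x := by
    intro x hx y hy
    have : Subgroup.closure s ≤ Subgroup.centralizer {y} :=
      (Subgroup.closure_le _).2 fun z hz =>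
        Subgroup.mem_centralizer_singleton_iff.2 (h1 z hz y hy)
    exact Subgroup.mem_centralizer_singleton_iff.1 (this hx)
  refine ⟨h2, fun x hx => ?_⟩
  induction hx using Subgroup.closure_induction with
  | mem x hx => exact hp x hx
  | one => exact one_pow p
  | mul x y hx hy ihx ihy => rw [Commute.mul_pow (h2 x hx y hy), ihx, ihy, one_mul]
  | inv x hx ih => rw [inv_pow, ih, inv_one]

theorem IsElementaryAbelian.sup {p : ℕ} {G : Type*} [Group G] {A B : Subgroup G}
    (hA : IsElementaryAbelian p A) (hB : IsElementaryAbelian p B)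
    (hAB : ∀ a ∈ A, ∀ b ∈ B, a * b = b * a) : IsElementaryAbelian p (A ⊔ B) := by
  rw [Subgroup.sup_eq_closure]
  refine isElementaryAbelian_closure ?_ ?_
  · rintro x (hx | hx) y (hy | hy)
    exacts [hA.1 x hx y hy, hAB x hx y hy, (hAB y hy x hx).symm, hB.1 x hx y hy]
  · rintro x (hx | hx)
    exacts [hA.2 x hx, hB.2 x hx]

theorem IsElementaryAbelian.mono {p : ℕ} {G : Type*} [Group G] {A B : Subgroup G}
    (hB : IsElementaryAbelian p B) (hAB : A ≤ B) : IsElementaryAbelian p A :=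
  ⟨fun x hx y hy => hB.1 x (hAB hx) y (hAB hy), fun x hx => hB.2 x (hAB hx)⟩

theorem IsMaxElementaryAbelian.le_of_commute {p : ℕ} {G : Type*} [Group G] [Finite G]
    {A B : Subgroup G} (hA : IsMaxElementaryAbelian p A) (hB : IsElementaryAbelian p B)
    (hAB : ∀ a ∈ A, ∀ b ∈ B, a * b = b * a) : B ≤ A := by
  have h := Subgroup.eq_of_le_of_card_ge (le_sup_left : A ≤ A ⊔ B)
    (hA.2 _ (hA.1.sup hB hAB))
  rw [h]
  exact le_sup_right

theorem exists_isMaxElementaryAbelian (p : ℕ) (G : Type*) [Group G] [Finite G] :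
    ∃ A : Subgroup G, IsMaxElementaryAbelian p A := by
  obtain ⟨A, hA, hmax⟩ := (Set.toFinite {A : Subgroup G | IsElementaryAbelian p A}).exists_maximalFor
    (fun A : Subgroup G => Nat.card A) _
    ⟨⊥, by simp [IsElementaryAbelian]⟩
  exact ⟨A, hA, fun B hB => (le_total (Nat.card B) (Nat.card A)).elim id (hmax hB)⟩

/-- In a nilpotent group, a set closed under taking commutators with elements of `T` which has a
nontrivial element has a nontrivial element commuting with all of `T`. -/
theorem exists_ne_one_forall_commute {G : Type*} [Group G] [Group.IsNilpotent G] {P T : Set G}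
    (hPT : ∀ a ∈ P, ∀ t ∈ T, ⁅t, a⁆ ∈ P) (hP : ∃ a ∈ P, a ≠ 1) :
    ∃ a ∈ P, a ≠ 1 ∧ ∀ t ∈ T, Commute t a := by
  classical
  have hex : ∃ n, ∃ a ∈ P, a ≠ 1 ∧ a ∈ Subgroup.upperCentralSeries G n := by
    obtain ⟨a, ha, ha1⟩ := hP
    obtain ⟨n, hn⟩ := Group.IsNilpotent.nilpotent G
    exact ⟨n, a, ha, ha1, hn ▸ Subgroup.mem_top a⟩
  -- Take `a` as low as possible in the upper central series: each `⁅t, a⁆` is again in `P` and one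
  -- level lower, hence trivial.
  obtain ⟨a, ha, ha1, han⟩ := Nat.find_spec hex
  refine ⟨a, ha, ha1, fun t ht => ?_⟩
  rw [← commutatorElement_eq_one_iff_commute]
  by_contra hne
  rcases hn : Nat.find hex with _ | n
  · rw [hn] at han
    exact ha1 (by simpa using han)
  · rw [hn, Subgroup.mem_upperCentralSeries_succ_iff] at han
    refine Nat.find_min hex (m := n) (by omega) ⟨_, hPT a ha t ht, hne, ?_⟩
    rw [← commutatorElement_inv]
    exact inv_mem (han t)

/-- A version of Thompson's replacement: for a normal elementary abelian subgroup `V`, an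
elementary abelian subgroup `A` of maximum order and `x ∈ V`, the subgroup `C_A(M) M` with
`M = [A, x]` is elementary abelian of maximum order. -/
theorem IsMaxElementaryAbelian.replacement {p : ℕ} {G : Type*} [Group G] [Finite G]
    {A V : Subgroup G} (hA : IsMaxElementaryAbelian p A) (hV : IsElementaryAbelian p V)
    (hVn : V.Normal) {x : G} (hx : x ∈ V) {M : Subgroup G}
    (hM : M = Subgroup.closure {y | ∃ a ∈ A, y = ⁅a, x⁆}) :
    IsMaxElementaryAbelian p ((A ⊓ Subgroup.centralizer (M : Set G)) ⊔ M) := by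
  have hMV : M ≤ V := by
    rw [hM, Subgroup.closure_le]
    rintro _ ⟨a, -, rfl⟩
    exact V.mul_mem (hVn.conj_mem x hx a) (inv_mem hx)
  set C := A ⊓ Subgroup.centralizer (M : Set G) with hC
  have hCM : IsElementaryAbelian p (C ⊔ M) :=
    (hA.1.mono inf_le_left).sup (hV.mono hMV) fun a ha b hb =>
      (Subgroup.mem_centralizer_iff.1 ha.2 b hb).symm
  -- With `d = b⁻¹ * a`, the left side is a conjugate of `⁅d, x⁆` by `b`. If it lies in `A`, then
  -- `A` centralizes `⁅d, x⁆`. Since `d` commutes with `A` and conjugates of `x` commute, `d` then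
  -- centralizes every `⁅e, x⁆`, hence `M`.
  have key : ∀ a ∈ A, ∀ b ∈ A, ⁅b, x⁆⁻¹ * ⁅a, x⁆ ∈ C → b⁻¹ * a ∈ C := by
    intro a ha b hb hab
    set d := b⁻¹ * a with hd
    have hdA : d ∈ A := mul_mem (inv_mem hb) ha
    have hconj : ∀ g, g * x * g⁻¹ ∈ V := fun g => hVn.conj_mem x hx g
    have e1 : ⁅b, x⁆⁻¹ * ⁅a, x⁆ = b * ⁅d, x⁆ * b⁻¹ := by
      have h := hV.1 _ (inv_mem (hconj b)) _ (hconj a)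
      have h' := hV.1 _ (inv_mem hx) _ (mul_mem (inv_mem (hconj b)) (hconj a))
      calc ⁅b, x⁆⁻¹ * ⁅a, x⁆ = x * ((b * x * b⁻¹)⁻¹ * (a * x * a⁻¹)) * x⁻¹ := by
            simp only [commutatorElement_def]; group
        _ = (b * x * b⁻¹)⁻¹ * (a * x * a⁻¹) := by
            rw [mul_assoc, ← h']; group
        _ = (a * x * a⁻¹) * (b * x * b⁻¹)⁻¹ := h
        _ = b * ⁅d, x⁆ * b⁻¹ := by
            simp only [commutatorElement_def, hd]; group
    have hdx : ∀ e ∈ A, e * ⁅d, x⁆ = ⁅d, x⁆ * e := by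
      intro e he
      have h := hA.1.1 e he _ hab.1
      have hbe := hA.1.1 e he b hb
      rw [e1] at h
      have h2 : b⁻¹ * e = e * b⁻¹ := (hA.1.1 e he _ (inv_mem hb)).symm
      calc e * ⁅d, x⁆ = b⁻¹ * (b * e) * ⁅d, x⁆ * b⁻¹ * b := by group
        _ = b⁻¹ * (e * (b * ⁅d, x⁆ * b⁻¹)) * b := by rw [← hbe]; group
        _ = ⁅d, x⁆ * (b⁻¹ * e) * b := by rw [h]; group
        _ = ⁅d, x⁆ * e := by rw [h2]; group
    refine ⟨hdA, ?_⟩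
    have hMd : M ≤ Subgroup.centralizer {d} := by
      rw [hM, Subgroup.closure_le]
      rintro _ ⟨e, he, rfl⟩
      rw [SetLike.mem_coe, Subgroup.mem_centralizer_singleton_iff]
      have h1 := hdx e he
      have hed := hA.1.1 e he d hdA
      have hy := hconj e
      have hdxd := hconj d
      have hdy : d * (e * x * e⁻¹) * d⁻¹ ∈ V := hVn.conj_mem _ hy d
      have e2 : d * (e * x * e⁻¹) * d⁻¹ * (e * x * e⁻¹)⁻¹ = (d * x * d⁻¹) * x⁻¹ := by
        calc _ = (d * e) * x * (d * e)⁻¹ * (e * x⁻¹ * e⁻¹) := by group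
          _ = (e * d) * x * (e * d)⁻¹ * (e * x⁻¹ * e⁻¹) := by rw [hed]
          _ = e * ⁅d, x⁆ * e⁻¹ := by simp only [commutatorElement_def]; group
          _ = (d * x * d⁻¹) * x⁻¹ := by rw [h1]; simp only [commutatorElement_def]; group
      have e3 : d * (e * x * e⁻¹) * d⁻¹ = (d * x * d⁻¹) * (x⁻¹ * (e * x * e⁻¹)) := by
        rw [← mul_assoc (d * x * d⁻¹), ← e2]; group
      have e4 : x⁻¹ * (e * x * e⁻¹) = (e * x * e⁻¹) * x⁻¹ := hV.1 _ (inv_mem hx) _ hy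
      have e5 := hV.1 _ hdxd _ (mul_mem hy (inv_mem hx))
      have e6 : d * (e * x * e⁻¹) * d⁻¹ = ⁅e, x⁆ * (d * x * d⁻¹) := by
        rw [e3, e4, e5, commutatorElement_def]
      calc ⁅e, x⁆ * d = ⁅e, x⁆ * (d * x * d⁻¹) * d * x⁻¹ := by group
        _ = d * (e * x * e⁻¹) * x⁻¹ := by rw [← e6]; group
        _ = d * ⁅e, x⁆ := by simp only [commutatorElement_def]; group
    refine Subgroup.mem_centralizer_iff.2 fun m hm => ?_
    exact Subgroup.mem_centralizer_singleton_iff.1 (hMd hm)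
  -- By `key`, a ↦ [a,x] induces an injection of A/C into M/(C ∩ M), so passing from A to CM loses
  -- no order.
  have hrel : C.relIndex A ≤ C.relIndex M := by
    have hmem : ∀ a ∈ A, ⁅a, x⁆ ∈ M := fun a ha => hM ▸ Subgroup.subset_closure ⟨a, ha, rfl⟩
    refine Nat.card_le_card_of_injective (fun q : A ⧸ C.subgroupOf A =>
      (QuotientGroup.mk ⟨⁅(q.out : G), x⁆, hmem _ q.out.2⟩ : M ⧸ C.subgroupOf M)) ?_
    intro q r hqr
    have h := QuotientGroup.eq.1 hqr
    rw [Subgroup.mem_subgroupOf] at h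
    have h2 := key _ r.out.2 _ q.out.2 h
    rw [← q.out_eq', ← r.out_eq']
    exact QuotientGroup.eq.2 h2
  have hcard : Nat.card A ≤ Nat.card (C ⊔ M : Subgroup G) := by
    rw [← Subgroup.relIndex_bot_left, ← Subgroup.relIndex_bot_left,
      ← Subgroup.relIndex_mul_relIndex ⊥ C A bot_le inf_le_left,
      ← Subgroup.relIndex_mul_relIndex ⊥ C (C ⊔ M) bot_le le_sup_left]
    exact Nat.mul_le_mul_left _
      (hrel.trans (Subgroup.relIndex_le_of_le_right le_sup_right Subgroup.index_ne_zero_of_finite))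
  exact ⟨hCM, fun B hB => (hA.2 B hB).trans hcard⟩

/-- Among the maximal elementary abelian A not centralizing V, one with |A ∩ V| largest is
normalized by V: otherwise replacement enlarges A ∩ V. Then [A,V] ≤ A, and A being abelian gives
[V,A,A] = 1. -/
theorem exists_forall_commute_commutator {p : ℕ} {G : Type*} [Group G] [Finite G]
    [Group.IsNilpotent G] {V : Subgroup G} (hV : IsElementaryAbelian p V) (hVn : V.Normal)
    (h : ¬ thompson p G ≤ Subgroup.centralizer (V : Set G)) :
    ∃ b, b ∉ Subgroup.centralizer (V : Set G) ∧ ∀ v ∈ V, Commute b ⁅b, v⁆ := by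
  have hne : {A : Subgroup G | IsMaxElementaryAbelian p A ∧
      ¬ A ≤ Subgroup.centralizer (V : Set G)}.Nonempty := by
    by_contra hemp
    refine h (sSup_le fun A hA => ?_)
    by_contra hAV
    exact hemp ⟨A, hA, hAV⟩
  obtain ⟨A, ⟨hA, hAV⟩, hmax⟩ := (Set.toFinite _).exists_maximalFor
    (fun A : Subgroup G => Nat.card (A ⊓ V : Subgroup G)) _ hne
  suffices hq : ∀ x ∈ V, ∀ a ∈ A, ⁅a, x⁆ ∈ A by
    obtain ⟨b, hb, hbV⟩ := SetLike.not_le_iff_exists.1 hAV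
    exact ⟨b, hbV, fun v hv => hA.1.1 b hb _ (hq v hv b hb)⟩
  intro x hx a ha
  set M := Subgroup.closure {y | ∃ a ∈ A, y = ⁅a, x⁆} with hM
  have hmem : ∀ a ∈ A, ⁅a, x⁆ ∈ M := fun a ha => Subgroup.subset_closure ⟨a, ha, rfl⟩
  have hMV : M ≤ V := by
    rw [hM, Subgroup.closure_le]
    rintro _ ⟨a, -, rfl⟩
    exact V.mul_mem (hVn.conj_mem x hx a) (inv_mem hx)
  have hB := hA.replacement hV hVn hx hM
  set C := A ⊓ Subgroup.centralizer (M : Set G) with hC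
  by_cases hBV : C ⊔ M ≤ Subgroup.centralizer (V : Set G)
  · have hVB : V ≤ C ⊔ M := hB.le_of_commute hV fun y hy v hv =>
      (Subgroup.mem_centralizer_iff.1 (hBV hy) v hv).symm
    -- Here x ∈ V ≤ AM. If x = cy with c ∈ A and y in the n-th lower central term, then M = [A,x]
    -- lies in the next term, so x ∈ AM improves the factorization. Nilpotency ends with x ∈ A.
    have hdesc : ∀ n, ∃ c ∈ A, ∃ y ∈ (⊤ : Subgroup G).lowerCentralSeries n, x = c * y := by
      intro n
      induction n with
      | zero => exact ⟨1, one_mem _, x, by simp, by simp⟩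
      | succ n ih =>
        obtain ⟨c, hc, y, hy, hxy⟩ := ih
        have hnorm : ((⊤ : Subgroup G).lowerCentralSeries (n + 1)).Normal := inferInstance
        have hMn : M ≤ (⊤ : Subgroup G).lowerCentralSeries (n + 1) := by
          rw [hM, Subgroup.closure_le]
          rintro _ ⟨e, he, rfl⟩
          have : ⁅e, x⁆ = c * ⁅e, y⁆ * c⁻¹ := by
            have hec := hA.1.1 e he c hc
            calc ⁅e, x⁆ = (e * c) * y * e⁻¹ * y⁻¹ * c⁻¹ := by
                  rw [hxy, commutatorElement_def]; group
              _ = c * ⁅e, y⁆ * c⁻¹ := by rw [hec, commutatorElement_def]; group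
          rw [this]
          refine hnorm.conj_mem _ ?_ c
          rw [← commutatorElement_inv]
          exact inv_mem (Subgroup.commutator_mem_commutator hy (Subgroup.mem_top e))
        have hxs : x ∈ A ⊔ (⊤ : Subgroup G).lowerCentralSeries (n + 1) :=
          sup_le_sup inf_le_left hMn (hVB hx)
        obtain ⟨c', hc', y', hy', h'⟩ := Subgroup.mem_sup_of_normal_right.1 hxs
        exact ⟨c', hc', y', hy', h'.symm⟩
    obtain ⟨n, hn⟩ := Subgroup.nilpotent_iff_lowerCentralSeries.1 ‹Group.IsNilpotent G›
    obtain ⟨c, hc, y, hy, hxy⟩ := hdesc n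
    rw [hn, Subgroup.mem_bot] at hy
    rw [hxy, hy, mul_one, commutatorElement_eq_one_iff_mul_comm.2 (hA.1.1 a ha c hc)]
    exact one_mem A
  -- A ∩ V centralizes M because both lie in V, so it survives in the replaced subgroup; maximality
  -- of |A ∩ V| then forces M ≤ A.
  · have hle : A ⊓ V ≤ (C ⊔ M) ⊓ V := by
      refine le_inf (le_trans (fun y hy => Subgroup.mem_inf.2 ⟨hy.1, ?_⟩) (le_sup_left : C ≤ _)) inf_le_right
      exact Subgroup.mem_centralizer_iff.2 fun m hm => hV.1 m (hMV hm) y hy.2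
    have hcard := hmax ⟨hB, hBV⟩ (Nat.card_le_card_of_injective _ (Subgroup.inclusion_injective hle))
    have heq := Subgroup.eq_of_le_of_card_ge hle hcard
    have : ⁅a, x⁆ ∈ A ⊓ V := heq ▸
      ⟨(le_sup_right : M ≤ C ⊔ M) (hmem a ha), hMV (hmem a ha)⟩
    exact this.1

/-! ### Quadratic sets, and quadratic elements in the center. -/

theorem exists_eq_conj_of_mem_conjugatesOfSet {G : Type*} [Group G] {a x : G}
    (hx : x ∈ Group.conjugatesOfSet {a}) : ∃ g, x = g * a * g⁻¹ := by
  obtain ⟨b, hb, hbx⟩ := Group.mem_conjugatesOfSet_iff.1 hx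
  obtain ⟨g, hg⟩ := isConj_iff.1 hbx
  exact ⟨g, by rw [← hg, Set.mem_singleton_iff.1 hb]⟩

/-- A conjugation invariant set of elements of exponent `p` that behaves like the set of elements
acting quadratically on a module of odd characteristic. -/
structure IsQuadraticSet (p : ℕ) {G : Type*} [Group G] (Q : Set G) : Prop where
  conj_mem : ∀ a ∈ Q, ∀ g : G, g * a * g⁻¹ ∈ Q
  mem_of_mul : ∀ a c : G, Commute a c → a ∈ Q → a * c ∈ Q → a * c ^ 2 ∈ Q → c ∈ Q
  pow_eq_one : ∀ a ∈ Q, a ^ p = 1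

namespace IsQuadraticSet

variable {p : ℕ} {G : Type*} [Group G] {Q : Set G}

/-- With c = [t,a], the elements a, ac and ac² are the conjugates of a by 1, t and t², so
`mem_of_mul` applies. -/
theorem commutator_mem (hQ : IsQuadraticSet p Q) {a t : G} (ha : a ∈ Q)
    (hca : Commute a ⁅t, a⁆) (hct : Commute t ⁅t, a⁆) : ⁅t, a⁆ ∈ Q := by
  have h1 : a * ⁅t, a⁆ = t * a * t⁻¹ := by
    rw [hca.eq, commutatorElement_def]; group
  have h2 : a * ⁅t, a⁆ ^ 2 = t ^ 2 * a * (t ^ 2)⁻¹ := by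
    calc a * ⁅t, a⁆ ^ 2 = (a * ⁅t, a⁆) * ⁅t, a⁆ := by rw [pow_two, mul_assoc]
      _ = t * a * (t⁻¹ * ⁅t, a⁆) := by rw [h1]; group
      _ = t * (a * ⁅t, a⁆) * t⁻¹ := by rw [hct.inv_left.eq]; group
      _ = t ^ 2 * a * (t ^ 2)⁻¹ := by rw [h1, pow_two]; group
  refine hQ.mem_of_mul a _ hca ha ?_ ?_
  · rw [h1]; exact hQ.conj_mem a ha t
  · rw [h2]; exact hQ.conj_mem a ha _

theorem preimage (hQ : IsQuadraticSet p Q) (K : Subgroup G) :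
    IsQuadraticSet p {a : K | (a : G) ∈ Q} where
  conj_mem := fun a ha g => hQ.conj_mem a ha g
  mem_of_mul := fun a c hac ha h1 h2 => hQ.mem_of_mul a c (congrArg Subtype.val hac) ha h1 h2
  pow_eq_one := fun a ha => Subtype.ext (hQ.pow_eq_one a ha)

theorem isElementaryAbelian_normalClosure (hQ : IsQuadraticSet p Q) {a : G} (ha : a ∈ Q)
    (hc : ∀ g : G, Commute a (g * a * g⁻¹)) :
    IsElementaryAbelian p (Subgroup.normalClosure {a}) := by
  refine isElementaryAbelian_closure ?_ ?_
  · intro x hx y hy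
    obtain ⟨g, rfl⟩ := exists_eq_conj_of_mem_conjugatesOfSet hx
    obtain ⟨h, rfl⟩ := exists_eq_conj_of_mem_conjugatesOfSet hy
    have := (hc (g⁻¹ * h)).eq
    calc g * a * g⁻¹ * (h * a * h⁻¹)
        = g * (a * (g⁻¹ * h * a * (g⁻¹ * h)⁻¹)) * g⁻¹ := by group
      _ = h * a * h⁻¹ * (g * a * g⁻¹) := by rw [this]; group
  · intro x hx
    obtain ⟨g, rfl⟩ := exists_eq_conj_of_mem_conjugatesOfSet hx
    exact hQ.pow_eq_one _ (hQ.conj_mem _ ha g)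

/-- If a normal elementary abelian subgroup meets `Q` nontrivially and `T` acts quadratically on
it, then `Q` has a nontrivial element in it centralized by `T`. -/
theorem exists_mem_forall_commute [Group.IsNilpotent G] (hQ : IsQuadraticSet p Q)
    {M : Subgroup G} (hM : ∀ x ∈ M, ∀ y ∈ M, x * y = y * x) {T : Set G}
    (hTM : ∀ t ∈ T, ∀ x ∈ M, ⁅t, x⁆ ∈ M ∧ Commute t ⁅t, x⁆) (h : ∃ a ∈ Q, a ∈ M ∧ a ≠ 1) :
    ∃ a ∈ Q, a ∈ M ∧ a ≠ 1 ∧ ∀ t ∈ T, Commute t a := by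
  obtain ⟨a, ⟨haQ, haM⟩, ha1, haT⟩ := exists_ne_one_forall_commute (P := {a | a ∈ Q ∧ a ∈ M})
    (T := T) (fun a ha t ht => ⟨hQ.commutator_mem ha.1 (hM a ha.2 _ (hTM t ht a ha.2).1)
      (hTM t ht a ha.2).2, (hTM t ht a ha.2).1⟩)
    (let ⟨a, h1, h2, h3⟩ := h; ⟨a, ⟨h1, h2⟩, h3⟩)
  exact ⟨a, haQ, haM, ha1, haT⟩

end IsQuadraticSet

/-- Induct into a maximal, hence normal, subgroup K. The normal closure M in K of the element found
there is abelian, and its G-conjugates are all normal in K. Thus [M, M^g] ≤ M ∩ M^g is centralized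
by M^g, so every conjugate of M acts quadratically on M. Some nontrivial quadratic element of M is
then centralized by all of these conjugates, in particular by its own. -/
theorem IsQuadraticSet.exists_commute_conj {p : ℕ} {G : Type*} [Group G] [Finite G]
    [Group.IsNilpotent G] {Q : Set G} (hQ : IsQuadraticSet p Q) (h : ∃ a ∈ Q, a ≠ 1) :
    ∃ a ∈ Q, a ≠ 1 ∧ ∀ g : G, Commute a (g * a * g⁻¹) := by
  induction hn : Nat.card G using Nat.strong_induction_on generalizing G with
  | _ n ih =>
    obtain ⟨a, ha, ha1⟩ := h
    rcases eq_top_or_exists_le_coatom (Subgroup.zpowers a) with htop | ⟨K, hK, haK⟩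
    · refine ⟨a, ha, ha1, fun g => ?_⟩
      obtain ⟨i, hi⟩ := Subgroup.mem_zpowers_iff.1
        (htop ▸ Subgroup.mem_top (g * a * g⁻¹) : g * a * g⁻¹ ∈ Subgroup.zpowers a)
      rw [← hi]
      exact (Commute.refl a).zpow_right i
    have hKn : K.Normal := Subgroup.NormalizerCondition.normal_of_coatom K
      (Group.normalizerCondition_of_isNilpotent) hK
    have hlt : Nat.card K < n := by
      rw [← hn]
      exact lt_of_le_of_ne (Subgroup.card_le_card_group K) fun he =>
        hK.1 (Subgroup.eq_top_of_card_eq K he)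
    obtain ⟨b, hb, hb1, hbc⟩ := ih _ hlt (hQ.preimage K)
      ⟨⟨a, haK (Subgroup.mem_zpowers a)⟩, ha, fun he => ha1 (congrArg Subtype.val he)⟩ rfl
    have hN := (hQ.preimage K).isElementaryAbelian_normalClosure hb hbc
    set N : Subgroup K := Subgroup.normalClosure {b} with hNdef
    set M : Subgroup G := N.map K.subtype with hMdef
    have hMK : M ≤ K := Subgroup.map_subtype_le N
    have hMc : ∀ x ∈ M, ∀ y ∈ M, x * y = y * x := by
      rintro _ ⟨x, hx, rfl⟩ _ ⟨y, hy, rfl⟩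
      exact congrArg Subtype.val (hN.1 x hx y hy)
    have hMn : ∀ x ∈ M, ∀ k ∈ K, k * x * k⁻¹ ∈ M := by
      rintro _ ⟨x, hx, rfl⟩ k hk
      exact ⟨_, Subgroup.normalClosure_normal.conj_mem x hx ⟨k, hk⟩, rfl⟩
    obtain ⟨c, hcQ, hcM, hc1, hc⟩ := hQ.exists_mem_forall_commute hMc
      (T := {t | ∃ g : G, ∃ m ∈ M, t = g * m * g⁻¹}) (by
        rintro _ ⟨g, m, hm, rfl⟩ x hx
        have hxK : g⁻¹ * x * g ∈ K := by simpa using hKn.conj_mem x (hMK hx) g⁻¹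
        refine ⟨?_, ?_⟩
        · exact mul_mem (hMn x hx _ (hKn.conj_mem m (hMK hm) g)) (inv_mem hx)
        · have h1 : ⁅g * m * g⁻¹, x⁆ =
              g * (m * ((g⁻¹ * x * g) * m⁻¹ * (g⁻¹ * x * g)⁻¹)) * g⁻¹ := by
            rw [commutatorElement_def]; group
          have h2 := hMc m hm _ (mul_mem hm (hMn _ (inv_mem hm) _ hxK))
          rw [h1]
          exact (Commute.conj_iff (h := g)).2 h2)
      ⟨b, hb, ⟨b, Subgroup.subset_normalClosure rfl, rfl⟩, fun he => hb1 (Subtype.ext he)⟩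
    exact ⟨c, hcQ, hc1, fun g => (hc _ ⟨g, c, hcM, rfl⟩).symm⟩

/-- If `G` is its own Baumann subgroup, then a nontrivial quadratic element may be found in the
center. -/
theorem IsQuadraticSet.exists_mem_center {p : ℕ} {G : Type*} [Group G] [Finite G]
    [Group.IsNilpotent G] {Q : Set G} (hQ : IsQuadraticSet p Q) (h : ∃ a ∈ Q, a ≠ 1)
    (hB : baumann p G = ⊤) : ∃ a ∈ Q, a ≠ 1 ∧ a ∈ Subgroup.center G := by
  obtain ⟨W, ⟨hW, hWn, hWQ⟩, hmin⟩ := (Set.toFinite {W : Subgroup G | IsElementaryAbelian p W ∧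
      W.Normal ∧ ∃ a ∈ Q, a ∈ W ∧ a ≠ 1}).exists_minimal (by
    obtain ⟨a, ha, ha1, hac⟩ := hQ.exists_commute_conj h
    exact ⟨_, hQ.isElementaryAbelian_normalClosure ha hac, Subgroup.normalClosure_normal,
      a, ha, Subgroup.subset_normalClosure rfl, ha1⟩)
  have hJ : thompson p G ≤ Subgroup.centralizer (W : Set G) := by
    by_contra hJ
    obtain ⟨b, hbW, hb⟩ := exists_forall_commute_commutator hW hWn hJ
    obtain ⟨a, haQ, haW, ha1, ha⟩ := hQ.exists_mem_forall_commute hW.1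
      (T := Group.conjugatesOfSet {b}) (by
        intro t ht x hx
        obtain ⟨g, rfl⟩ := exists_eq_conj_of_mem_conjugatesOfSet ht
        refine ⟨mul_mem (hWn.conj_mem x hx _) (inv_mem hx), ?_⟩
        have h1 := hb (g⁻¹ * x * g) (by simpa using hWn.conj_mem x hx g⁻¹)
        have h2 := (Commute.conj_iff (h := g)).2 h1
        have h3 : g * ⁅b, g⁻¹ * x * g⁆ * g⁻¹ = ⁅g * b * g⁻¹, x⁆ := by
          rw [commutatorElement_def, commutatorElement_def]; group
        rwa [h3] at h2) hWQ
    -- The smaller normal subgroup still meets `Q` nontrivially, so by minimality all of `W`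
    -- commutes with `b`, contrary to the choice of `b`.
    have hle := hmin (y := W ⊓ Subgroup.centralizer (Subgroup.normalClosure {b} : Set G))
      ⟨hW.mono inf_le_left, inferInstance, a, haQ, ⟨haW, by
        rw [Subgroup.normalClosure, Subgroup.centralizer_closure]
        exact Subgroup.mem_centralizer_iff.2 fun t ht => ha t ht⟩, ha1⟩ inf_le_left
    exact hbW (Subgroup.mem_centralizer_iff.2 fun w hw =>
      (Subgroup.mem_centralizer_iff.1 (hle hw).2 b (Subgroup.subset_normalClosure rfl)).symm)
  obtain ⟨a, haQ, haW, ha1⟩ := hWQ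
  refine ⟨a, haQ, ha1, ?_⟩
  have hcomm : ∀ x ∈ thompson p G, x * a = a * x := fun x hx =>
    (Subgroup.mem_centralizer_iff.1 (hJ hx) a haW).symm
  -- Any elementary abelian subgroup of maximum order is centralized by `W`, hence contains `W`.
  have haJ : a ∈ thompson p G := by
    obtain ⟨A, hA⟩ := exists_isMaxElementaryAbelian p G
    have hAJ : A ≤ thompson p G := le_sSup hA
    exact hAJ (hA.le_of_commute hW (fun x hx w hw =>
      (Subgroup.mem_centralizer_iff.1 (hJ (hAJ hx)) w hw).symm) haW)
  have hmem : a ∈ omegaOne p (centerOf (thompson p G)) :=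
    Subgroup.subset_closure ⟨⟨haJ, Subgroup.mem_centralizer_iff.2 hcomm⟩, hQ.pow_eq_one a haQ⟩
  rw [Subgroup.mem_center_iff]
  intro g
  have hg : g ∈ baumann p G := hB ▸ Subgroup.mem_top g
  exact (Subgroup.mem_centralizer_iff.1 hg a hmem).symm

/-! ### Quadratic elements in rings and in faithful actions. -/

/-- Put α = a - 1 and u = ac - 1, both of square zero. Then c - 1 = u - α - uα has square -2uα,
while ac² - 1 = 2u - α - 2uα has square -4uα. The latter vanishes, and 2 can be cancelled. -/
theorem sub_one_sq_eq_zero_of_commRing {R : Type*} [CommRing R] (h2 : ∀ x : R, 2 * x = 0 → x = 0)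
    {a c : R} (ha : (a - 1) ^ 2 = 0) (hac : (a * c - 1) ^ 2 = 0) (hacc : (a * c ^ 2 - 1) ^ 2 = 0) :
    (c - 1) ^ 2 = 0 := by
  obtain ⟨α, hα⟩ : ∃ α, α = a - 1 := ⟨_, rfl⟩
  obtain ⟨u, hu⟩ : ∃ u, u = a * c - 1 := ⟨_, rfl⟩
  have hc : c = (1 + u) * (1 - α) := by
    rw [hu, hα]; linear_combination c * ha
  have hacc' : a * c ^ 2 = (1 + u) ^ 2 * (1 - α) := by
    calc a * c ^ 2 = (1 + u) * c := by rw [hu]; ring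
      _ = (1 + u) ^ 2 * (1 - α) := by rw [hc]; ring
  rw [← hα] at ha
  rw [← hu] at hac
  rw [hacc'] at hacc
  apply h2
  rw [hc]
  linear_combination hacc + (2 + 2 * α ^ 2 - 4 * α - 4 - 4 * α ^ 2 + 8 * α -
    (1 - α) * (2 * (2 * u - α - 2 * u * α) + u ^ 2 * (1 - α))) * hac + ha

open scoped IsMulCommutative in
theorem sub_one_sq_eq_zero {R : Type*} [Ring R] (h2 : ∀ x : R, 2 * x = 0 → x = 0) {a c : R}
    (h : Commute a c) (ha : (a - 1) ^ 2 = 0) (hac : (a * c - 1) ^ 2 = 0)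
    (hacc : (a * c ^ 2 - 1) ^ 2 = 0) : (c - 1) ^ 2 = 0 := by
  have hcomm : ∀ x ∈ ({a, c} : Set R), ∀ y ∈ ({a, c} : Set R), x * y = y * x := by
    rintro x (rfl | rfl) y (rfl | rfl)
    exacts [rfl, h, h.symm, rfl]
  have := Subring.isMulCommutative_closure hcomm
  have ha' : a ∈ Subring.closure {a, c} := Subring.subset_closure (by simp)
  have hc' : c ∈ Subring.closure {a, c} := Subring.subset_closure (by simp)
  have := sub_one_sq_eq_zero_of_commRing (R := Subring.closure {a, c}) (a := ⟨a, ha'⟩)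
    (c := ⟨c, hc'⟩) (fun x hx => Subtype.ext (h2 x (congrArg Subtype.val hx)))
    (Subtype.ext ha) (Subtype.ext hac) (Subtype.ext hacc)
  exact congrArg Subtype.val this

theorem pow_eq_of_sub_one_sq_eq_zero {R : Type*} [Ring R] {a : R} (ha : (a - 1) ^ 2 = 0) (n : ℕ) :
    a ^ n = 1 + n * (a - 1) := by
  induction n with
  | zero => simp
  | succ n ih =>
    have h : a * a = a + a - 1 := by
      rw [pow_two] at ha
      calc a * a = (a - 1) * (a - 1) + (a + a - 1) := by noncomm_ring
        _ = _ := by rw [ha, zero_add]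
    rw [pow_succ, ih, add_mul, mul_assoc, sub_mul, h]
    push_cast
    noncomm_ring

theorem isQuadraticSet_of_hom {p : ℕ} {G R : Type*} [Group G] [Ring R]
    (h2 : ∀ x : R, 2 * x = 0 → x = 0) (hp : (p : R) = 0) {f : G →* R}
    (hf : ∀ g, f g = 1 → g = 1) : IsQuadraticSet p {g | (f g - 1) ^ 2 = 0} where
  conj_mem := by
    intro a ha g
    have h1 : f g⁻¹ * f g = 1 := by rw [← map_mul, inv_mul_cancel, map_one]
    have h3 : f g * f g⁻¹ = 1 := by rw [← map_mul, mul_inv_cancel, map_one]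
    have h4 : f (g * a * g⁻¹) - 1 = f g * (f a - 1) * f g⁻¹ := by
      rw [map_mul, map_mul, mul_sub, sub_mul, mul_one, h3]
    change (f a - 1) ^ 2 = 0 at ha
    change _ = _
    rw [h4, pow_two]
    calc _ = f g * ((f a - 1) * (f g⁻¹ * f g) * (f a - 1)) * f g⁻¹ := by simp only [mul_assoc]
      _ = 0 := by rw [h1, mul_one, ← pow_two, ha, mul_zero, zero_mul]
  mem_of_mul := by
    intro a c hac h3 h4 h5
    refine sub_one_sq_eq_zero h2 (hac.map f) h3 ?_ ?_
    · rw [← map_mul]; exact h4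
    · rw [← map_pow, ← map_mul]; exact h5
  pow_eq_one := by
    intro a ha
    apply hf
    rw [map_pow, pow_eq_of_sub_one_sq_eq_zero ha, hp, zero_mul, add_zero]

theorem eq_zero_of_two_mul_eq_zero {R : Type*} [Ring R] {p : ℕ} (hp : Odd p) (hpR : (p : R) = 0)
    (x : R) (hx : 2 * x = 0) : x = 0 := by
  obtain ⟨m, rfl⟩ := hp
  have h : ((2 * m + 1 : ℕ) : R) * x = 0 := by rw [hpR, zero_mul]
  push_cast at h
  rw [add_mul, one_mul, (Nat.cast_commute m (2 : R)).eq.symm, mul_assoc, hx, mul_zero,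
    zero_add] at h
  exact h

/-- An action on a commutative group, as a map to its additive endomorphism ring. -/
def endOfMulAut {B : Type*} [CommGroup B] : MulAut B →* AddMonoid.End (Additive B) where
  toFun e := MonoidHom.toAdditive e.toMonoidHom
  map_one' := rfl
  map_mul' _ _ := rfl

theorem isQuadraticSet_of_action {p : ℕ} (hp : Odd p) {G B : Type*} [Group G] [CommGroup B]
    (hB : ∀ b : B, b ^ p = 1) {φ : G →* MulAut B} (hφ : ∀ g, φ g = 1 → g = 1) :
    IsQuadraticSet p {g | ∀ b, φ g (φ g b / b) = φ g b / b} := by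
  have hp0 : (p : AddMonoid.End (Additive B)) = 0 :=
    AddMonoidHom.ext fun v => (AddMonoid.End.natCast_apply p v).trans (hB v.toMul)
  have h := isQuadraticSet_of_hom (eq_zero_of_two_mul_eq_zero hp hp0) hp0
    (f := endOfMulAut.comp φ) fun g hg => hφ g (MulEquiv.ext fun b => DFunLike.congr_fun hg
      (Additive.ofMul b))
  -- Written additively, the fixed-point condition is (g - 1)² = 0 in the endomorphism ring of B.
  convert h using 1
  ext g
  have key : ∀ b : B, ((endOfMulAut (φ g) - 1) ^ 2 : AddMonoid.End (Additive B)) (Additive.ofMul b) =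
      Additive.ofMul (φ g (φ g b / b) / (φ g b / b)) := by
    intro b
    rw [pow_two]
    rfl
  constructor
  · intro hg
    refine AddMonoidHom.ext fun b => (key b.toMul).trans ?_
    exact congrArg Additive.ofMul (div_eq_one.2 (hg b.toMul))
  · intro hg b
    have h1 := key b
    change (endOfMulAut (φ g) - 1) ^ 2 = 0 at hg
    rw [hg] at h1
    exact div_eq_one.1 h1.symm

/-! ### Extending Oliver series, and the action of S/X on V. -/

theorem iterCommutator_eq_bot_of_le {S : Type*} [Group S] {A B : Subgroup S} {m n : ℕ}
    (hmn : m ≤ n) (h : iterCommutator A B m = ⊥) : iterCommutator A B n = ⊥ := by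
  induction n, hmn using Nat.le_induction with
  | base => exact h
  | succ n _ ih => rw [iterCommutator, ih, Subgroup.commutator_bot_left]

theorem le_oliverK_of_iterCommutator_eq_bot {p k m : ℕ} {S : Type*} [Group S] [Finite S]
    {K : Subgroup S} (hK : K.Normal) (hle : oliverK p k S ≤ K) (hm : m ≤ k - 1)
    (h : iterCommutator (omegaOne p (Subgroup.centralizer (oliverK p k S : Set S))) K m = ⊥) :
    K ≤ oliverK p k S :=
  (isGreatest_oliverK p k S).2
    ((isGreatest_oliverK p k S).1.extend hK hle (iterCommutator_eq_bot_of_le hm h))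

section CentralExtension

variable {S : Type*} [Group S] {X : Subgroup S} {s : S}

theorem commutator_mem_of_mem_sup_zpowers [X.Normal] (hs : (s : S ⧸ X) ∈ Subgroup.center (S ⧸ X)) (g : S)
    {y : S} (hy : y ∈ X ⊔ Subgroup.zpowers s) : ⁅g, y⁆ ∈ X := by
  have hle : X ⊔ Subgroup.zpowers s ≤ (Subgroup.center (S ⧸ X)).comap (QuotientGroup.mk' X) := by
    refine sup_le (fun x hx => ?_) ?_
    · rw [Subgroup.mem_comap, QuotientGroup.mk'_apply, (QuotientGroup.eq_one_iff x).2 hx]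
      exact one_mem _
    · rw [Subgroup.zpowers_le]
      exact hs
  have hc := Subgroup.mem_center_iff.1 (hle hy) (g : S ⧸ X)
  rw [← QuotientGroup.eq_one_iff]
  exact commutatorElement_eq_one_iff_mul_comm.2 hc

theorem normal_sup_zpowers [X.Normal] (hs : (s : S ⧸ X) ∈ Subgroup.center (S ⧸ X)) :
    (X ⊔ Subgroup.zpowers s).Normal where
  conj_mem y hy g := by
    have := mul_mem ((le_sup_left : X ≤ X ⊔ Subgroup.zpowers s)
      (commutator_mem_of_mem_sup_zpowers hs g hy)) hy
    rwa [commutatorElement_def, inv_mul_cancel_right] at this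

theorem le_centralizer_sup_zpowers {D : Subgroup S}
    (hX : ∀ d ∈ D, ∀ x ∈ X, x * d = d * x) (hs : ∀ d ∈ D, s * d = d * s) :
    D ≤ Subgroup.centralizer ((X ⊔ Subgroup.zpowers s : Subgroup S) : Set S) := by
  rw [Subgroup.le_centralizer_iff]
  refine sup_le (fun x hx => ?_) ?_
  · exact Subgroup.mem_centralizer_iff.2 fun d hd => (hX d hd x hx).symm
  · rw [Subgroup.zpowers_le]
    exact Subgroup.mem_centralizer_iff.2 fun d hd => (hs d hd).symm

end CentralExtension

section Oliver

variable {p k : ℕ} {S : Type*} [Group S]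

theorem omegaOne_commute_oliverK {v x : S}
    (hv : v ∈ omegaOne p (Subgroup.centralizer (oliverK p k S : Set S)))
    (hx : x ∈ oliverK p k S) : x * v = v * x :=
  Subgroup.mem_centralizer_iff.1 (omegaOne_le p _ hv) x hx

theorem iterCommutator_two_eq_bot_iff {A B : Subgroup S} :
    iterCommutator A B 2 = ⊥ ↔ ⁅A, B⁆ ≤ Subgroup.centralizer (B : Set S) := by
  rw [← Subgroup.commutator_eq_bot_iff_le_centralizer]
  rfl

/-- Otherwise the image of C_S(X) in S/X contains a nontrivial central element, with a lift s ∈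
C_S(X). Then [V, X⟨s⟩] ≤ V ∩ X is centralized by both X and s, so X⟨s⟩ extends the series. -/
theorem centralizer_oliverK_le [Finite S] [Group.IsNilpotent S] (hk : 3 ≤ k) :
    Subgroup.centralizer (oliverK p k S : Set S) ≤ oliverK p k S := by
  by_contra hle
  obtain ⟨c, hc, hcX⟩ := SetLike.not_le_iff_exists.1 hle
  set X := oliverK p k S with hX
  obtain ⟨_, ⟨s, hs, rfl⟩, hs1, hsc⟩ := exists_ne_one_forall_commute
    (P := {a : S ⧸ X | ∃ s ∈ Subgroup.centralizer (X : Set S), (s : S ⧸ X) = a}) (T := Set.univ)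
    (by
      rintro _ ⟨s, hs, rfl⟩ t -
      obtain ⟨t, rfl⟩ := QuotientGroup.mk_surjective t
      refine ⟨⁅t, s⁆, ?_, rfl⟩
      exact mul_mem (Subgroup.Normal.conj_mem inferInstance s hs t) (inv_mem hs))
    ⟨c, ⟨c, hc, rfl⟩, fun h => hcX ((QuotientGroup.eq_one_iff c).1 h)⟩
  have hsX : s ∉ X := fun h => hs1 ((QuotientGroup.eq_one_iff s).2 h)
  have hcen : (s : S ⧸ X) ∈ Subgroup.center (S ⧸ X) :=
    Subgroup.mem_center_iff.2 fun g => (hsc g trivial).eq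
  have hKn := normal_sup_zpowers hcen
  refine hsX (le_oliverK_of_iterCommutator_eq_bot hKn le_sup_left (m := 2) (by omega)
    (iterCommutator_two_eq_bot_iff.2 ?_)
    ((le_sup_right : Subgroup.zpowers s ≤ X ⊔ Subgroup.zpowers s) (Subgroup.mem_zpowers s)))
  set W := omegaOne p (Subgroup.centralizer (X : Set S)) with hW
  have hWn : W.Normal := omegaOne_normal p inferInstance
  have h1 : ⁅W, X ⊔ Subgroup.zpowers s⁆ ≤ W := Subgroup.commutator_le_left _ _
  have h2 : ⁅W, X ⊔ Subgroup.zpowers s⁆ ≤ X := by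
    rw [Subgroup.commutator_le]
    exact fun w _ y hy => commutator_mem_of_mem_sup_zpowers hcen w hy
  refine le_centralizer_sup_zpowers (fun d hd x hx => omegaOne_commute_oliverK (h1 hd) hx)
    fun d hd => ?_
  exact (Subgroup.mem_centralizer_iff.1 hs d (h2 hd)).symm

theorem isElementaryAbelian_omegaOne_centralizer_oliverK [Finite S] [Group.IsNilpotent S] (hk : 3 ≤ k) :
    IsElementaryAbelian p (omegaOne p (Subgroup.centralizer (oliverK p k S : Set S))) :=
  isElementaryAbelian_closure
    (fun x hx _ hy => Subgroup.mem_centralizer_iff.1 hy.1 x (centralizer_oliverK_le hk hx.1))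
    fun _ hx => hx.2

/-- C_S(V) is normal, contains X and satisfies [V, C_S(V)] = 1, so it too extends the series. -/
theorem centralizer_omegaOne_centralizer_oliverK [Finite S] (hk : 3 ≤ k) :
    Subgroup.centralizer
      (omegaOne p (Subgroup.centralizer (oliverK p k S : Set S)) : Set S) = oliverK p k S := by
  have hWn : (omegaOne p (Subgroup.centralizer (oliverK p k S : Set S))).Normal :=
    omegaOne_normal p inferInstance
  have hle : oliverK p k S ≤ Subgroup.centralizer
      (omegaOne p (Subgroup.centralizer (oliverK p k S : Set S)) : Set S) :=
    Subgroup.le_centralizer_iff.1 (omegaOne_le p _)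
  refine le_antisymm (le_oliverK_of_iterCommutator_eq_bot inferInstance hle (m := 1) (by omega) ?_)
    hle
  exact Subgroup.commutator_eq_bot_iff_le_centralizer.2 (Subgroup.le_centralizer_iff.1 le_rfl)

theorem mem_oliverK_of_forall_commute [Finite S] (hk : 3 ≤ k) {s : S}
    (hcen : (s : S ⧸ oliverK p k S) ∈ Subgroup.center (S ⧸ oliverK p k S))
    (hs : ∀ v ∈ omegaOne p (Subgroup.centralizer (oliverK p k S : Set S)), Commute s ⁅s, v⁆) :
    s ∈ oliverK p k S := by
  have hKn := normal_sup_zpowers hcen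
  set X := oliverK p k S with hX
  set K := X ⊔ Subgroup.zpowers s with hK
  set W := omegaOne p (Subgroup.centralizer (X : Set S)) with hW
  have hWn : W.Normal := omegaOne_normal p inferInstance
  have hXW : ∀ w ∈ W, ∀ x ∈ X, x * w = w * x := fun w hw x hx => omegaOne_commute_oliverK hw hx
  have hsK : s ∈ K := (le_sup_right : Subgroup.zpowers s ≤ K) (Subgroup.mem_zpowers s)
  refine le_oliverK_of_iterCommutator_eq_bot hKn le_sup_left (m := 2) (by omega)
    (iterCommutator_two_eq_bot_iff.2 ?_) hsK
  -- Quadratic action puts every [s,w] in D = C_W(K). Since X centralizes W, all of K acts trivially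
  -- on W/D; hence [W,K] ≤ D, which K centralizes.
  set D := W ⊓ Subgroup.centralizer (K : Set S) with hD
  have hDn : D.Normal := inferInstance
  have hsD : ∀ w ∈ W, ⁅s, w⁆ ∈ D := by
    intro w hw
    have hmem : ⁅s, w⁆ ∈ W := mul_mem (hWn.conj_mem w hw s) (inv_mem hw)
    have hle : Subgroup.zpowers ⁅s, w⁆ ≤ Subgroup.centralizer (K : Set S) := by
      refine le_centralizer_sup_zpowers
        (fun d hd x hx => hXW d ((Subgroup.zpowers_le.2 hmem) hd) x hx) fun d hd => ?_
      obtain ⟨i, rfl⟩ := Subgroup.mem_zpowers_iff.1 hd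
      exact (hs w hw).zpow_right i
    exact ⟨hmem, hle (Subgroup.mem_zpowers _)⟩
  have hKL : K ≤ (Subgroup.centralizer ((W.map (QuotientGroup.mk' D) : Subgroup (S ⧸ D)) :
      Set (S ⧸ D))).comap (QuotientGroup.mk' D) := by
    refine sup_le (fun x hx => ?_) (Subgroup.zpowers_le.2 ?_)
    · refine Subgroup.mem_centralizer_iff.2 ?_
      rintro _ ⟨w, hw, rfl⟩
      rw [← map_mul, ← hXW w hw x hx, map_mul]
    · refine Subgroup.mem_centralizer_iff.2 ?_
      rintro _ ⟨w, hw, rfl⟩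
      exact (commutatorElement_eq_one_iff_mul_comm.1
        ((QuotientGroup.eq_one_iff (N := D) ⁅s, w⁆).2 (hsD w hw))).symm
  have hWK : ⁅W, K⁆ ≤ D := by
    rw [Subgroup.commutator_le]
    intro w hw y hy
    rw [← QuotientGroup.eq_one_iff]
    exact commutatorElement_eq_one_iff_mul_comm.2
      (Subgroup.mem_centralizer_iff.1 (hKL hy) _ ⟨w, hw, rfl⟩)
  exact hWK.trans inf_le_right

theorem thompson_le_oliverK [Finite S] [Group.IsNilpotent S] (hp : Odd p) (hk : 3 ≤ k)
    (hB : baumann p (S ⧸ oliverK p k S) = ⊤) : thompson p S ≤ oliverK p k S := by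
  by_contra hJ
  have hV := isElementaryAbelian_omegaOne_centralizer_oliverK (p := p) (k := k) (S := S) hk
  have hcent := centralizer_omegaOne_centralizer_oliverK (p := p) (k := k) (S := S) hk
  have hmem := fun s => mem_oliverK_of_forall_commute (p := p) (k := k) (S := S) (s := s) hk
  have hVn : (omegaOne p (Subgroup.centralizer (oliverK p k S : Set S))).Normal :=
    omegaOne_normal p inferInstance
  set V := omegaOne p (Subgroup.centralizer (oliverK p k S : Set S)) with hVdef
  rw [← hcent] at hJ
  obtain ⟨b, hbV, hb⟩ := exists_forall_commute_commutator hV hVn hJ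
  let _ : CommGroup V := { mul_comm := fun x y => Subtype.ext (hV.1 x x.2 y y.2) }
  have hconj : ∀ s : S, (MulAut.conjNormal s : MulAut V) = 1 ↔ s ∈ oliverK p k S := by
    intro s
    rw [← hcent, Subgroup.mem_centralizer_iff]
    constructor
    · intro h v hv
      have h1 := congrArg Subtype.val (DFunLike.congr_fun h (⟨v, hv⟩ : V))
      rw [MulAut.conjNormal_apply] at h1
      exact (mul_inv_eq_iff_eq_mul.1 h1).symm
    · intro h
      refine MulEquiv.ext fun v => Subtype.ext ?_
      rw [MulAut.conjNormal_apply, ← h v v.2, mul_inv_cancel_right]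
      rfl
  have hquad : ∀ s : S, (∀ v : V, MulAut.conjNormal s (MulAut.conjNormal s v / v) =
      MulAut.conjNormal s v / v) ↔ ∀ v ∈ V, Commute s ⁅s, v⁆ := by
    intro s
    refine Subtype.forall.trans (forall₂_congr fun v hv => ?_)
    rw [Subtype.ext_iff, MulAut.conjNormal_apply]
    change s * (s * v * s⁻¹ / v) * s⁻¹ = s * v * s⁻¹ / v ↔ _
    rw [div_eq_mul_inv, mul_inv_eq_iff_eq_mul]
    rfl
  -- Conjugation on V has kernel exactly X, so it descends to a faithful action of S/X.
  have hQ := isQuadraticSet_of_action (p := p) hp (fun v : V => Subtype.ext (hV.2 v v.2))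
    (φ := QuotientGroup.lift (oliverK p k S) MulAut.conjNormal fun s hs => (hconj s).2 hs)
    fun g hg => by
      obtain ⟨s, rfl⟩ := QuotientGroup.mk_surjective g
      exact (QuotientGroup.eq_one_iff s).2 ((hconj s).1 hg)
  obtain ⟨z, hz, hz1, hzc⟩ := hQ.exists_mem_center
    ⟨b, (hquad b).2 hb, fun h => hbV (by
      rw [hcent]; exact (QuotientGroup.eq_one_iff b).1 h)⟩ hB
  obtain ⟨s, rfl⟩ := QuotientGroup.mk_surjective z
  exact hz1 ((QuotientGroup.eq_one_iff s).2 (hmem s hzc ((hquad s).1 hz)))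

end Oliver

end OliverGroup

theorem mainTheorem2 (p : ℕ) (hp : p.Prime) (hp5 : 5 ≤ p)
    (S : Type*) [Group S] [Finite S] (hS : IsPGroup p S) :
    (∀ k : ℕ, 3 ≤ k → k ≤ p →
      OliverGroup.baumann p (S ⧸ OliverGroup.oliverK p k S) = ⊤ →
      OliverGroup.thompson p S ≤ OliverGroup.oliverK p k S) ∧
    (OliverGroup.baumann p (S ⧸ OliverGroup.oliver p S) = ⊤ →
      OliverGroup.thompson p S ≤ OliverGroup.oliver p S) := by
  have : Fact p.Prime := ⟨hp⟩
  have : Group.IsNilpotent S := hS.isNilpotent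
  have hodd : Odd p := hp.odd_of_ne_two (by omega)
  exact ⟨fun k hk _ hB => OliverGroup.thompson_le_oliverK hodd hk hB,
    fun hB => OliverGroup.thompson_le_oliverK hodd (by omega) hB⟩
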